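/- Let $\mathbb{K}$ be an algebraically closed field of characteristic $0$. A subvariety of $\mathbb{P}^n=\mathbb{P}^n_{\mathbb{K}}$ is an irreducible (hence non-empty) Zariski closed subset. For subvarieties $X,Y\subseteq\mathbb{P}^n$ the Hadamard product $X\star Y\subseteq\mathbb{P}^n$ is the Zariski closure of the set of all points $[p_0q_0:\dots:p_nq_n]$ with $[p_0:\dots:p_n]\in X$, $[q_0:\dots:q_n]\in Y$ and $p_iq_i\neq 0$ for at least one $i$. For a Zariski closed set $V\subseteq\mathbb{P}^n$ with homogeneous ideal $I(V)\subseteq S=\mathbb{K}[x_0,\dots,x_n]$, let $HF_V(t)=\dim_{\mathbb{K}}(S/I(V))_t$ be its Hilbert function, $\dim V$ its dimension as a topological space, and $\deg V$ its degree, i.e. $(\dim V)!$ times the leading coefficient of its Hilbert polynomial. Let $n,h,k\geq 0$ be integers with $n\geq (h+1)(k+1)-1$, and let $L_h$ and $L_k$ be generic linear subspaces of $\mathbb{P}^n$ of dimensions $h$ and $k$ respectively; that is, the following holds for all pairs $(L_h,L_k)$ in some non-empty Zariski open subset, depending only on $\mathbb{K},n,h,k$, of the product of the two Grassmannians. Let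 $X\subseteq L_h$ be a subvariety of dimension $r$ and degree $d_X$, and let $Y\subseteq L_k$ be a subvariety of dimension $s$ and degree $d_Y$. Then \begin{enumerate} \item[i)] $\dim(X\star Y)=r+s$; \item[ii)] $\deg(X\star Y)=\binom{r+s}{s}\,d_X\,d_Y$; \item[iii)] $HF_{X\star Y}(t)=HF_X(t)\cdot HF_Y(t)$ for all integers $t\geq 0$. \end{enumerate} -/

import Mathlib

open MvPolynomial Filter

noncomputable section

namespace HadamardProj

/-- Projective `n`-space over `K`: the lines of `K^(n+1)`. -/
abbrev PSpace (K : Type*) [Field K] (n : ℕ) : Type _ :=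
  Projectivization K (Fin (n + 1) → K)

/-- The polynomial `f` is a form, i.e. homogeneous of some degree. -/
def IsForm {K : Type*} [Field K] {n : ℕ} (f : MvPolynomial (Fin (n + 1)) K) : Prop :=
  ∃ d : ℕ, f.IsHomogeneous d

/-- The common zeros in projective space of a set `T` of forms. (For a form, vanishing at a point
does not depend on the representative.) -/
def zeros {K : Type*} [Field K] {n : ℕ} (T : Set (MvPolynomial (Fin (n + 1)) K)) :
    Set (PSpace K n) :=
  {p | ∀ f ∈ T, eval p.rep f = 0}

/-- The Zariski topology on projective space: the closed sets are the common zeros of sets of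
forms. -/
instance zariskiTopology (K : Type*) [Field K] (n : ℕ) : TopologicalSpace (PSpace K n) :=
  TopologicalSpace.ofClosed
    {Z | ∃ T : Set (MvPolynomial (Fin (n + 1)) K), (∀ f ∈ T, IsForm f) ∧ Z = zeros T}
    (by
      refine ⟨{1}, ?_, ?_⟩
      · rintro f rfl
        exact ⟨0, isHomogeneous_one _ _⟩
      · ext p
        simp [zeros])
    (by
      intro A hA
      refine ⟨{f | IsForm f ∧ ∃ Z ∈ A, ∀ p ∈ Z, eval p.rep f = 0}, fun f hf => hf.1, ?_⟩
      ext p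
      constructor
      · rintro hp f ⟨-, Z, hZ, hfZ⟩
        exact hfZ p (hp Z hZ)
      · intro hp Z hZ
        obtain ⟨T, hT, hZT⟩ := hA hZ
        rw [hZT]
        intro f hf
        refine hp f ⟨hT f hf, Z, hZ, fun q hq => ?_⟩
        rw [hZT] at hq
        exact hq f hf)
    (by
      rintro _ ⟨S, hS, rfl⟩ _ ⟨T, hT, rfl⟩
      refine ⟨{f | ∃ a ∈ S, ∃ b ∈ T, f = a * b}, ?_, ?_⟩
      · rintro _ ⟨a, ha, b, hb, rfl⟩
        obtain ⟨d, hd⟩ := hS a ha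
        obtain ⟨e, he⟩ := hT b hb
        exact ⟨d + e, hd.mul he⟩
      · ext p
        constructor
        · rintro (hp | hp) _ ⟨a, ha, b, hb, rfl⟩
          · simp [hp a ha]
          · simp [hp b hb]
        · intro hp
          by_contra hcon
          have h1 : p ∉ zeros S := fun h => hcon (Or.inl h)
          have h2 : p ∉ zeros T := fun h => hcon (Or.inr h)
          simp only [zeros, Set.mem_ofPred_eq, not_forall] at h1 h2
          obtain ⟨a, ha, ha0⟩ := h1
          obtain ⟨b, hb, hb0⟩ := h2
          have h3 := hp (a * b) ⟨a, ha, b, hb, rfl⟩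
          rw [map_mul] at h3
          exact (mul_ne_zero ha0 hb0) h3)

/-- A projective (sub)variety: an irreducible (in particular non-empty) Zariski closed subset of
projective space. -/
def IsVariety {K : Type*} [Field K] {n : ℕ} (X : Set (PSpace K n)) : Prop :=
  IsClosed X ∧ IsIrreducible X

/-- The homogeneous ideal of `X`: generated by the forms that vanish on `X`. -/
def homogeneousIdeal {K : Type*} [Field K] {n : ℕ} (X : Set (PSpace K n)) :
    Ideal (MvPolynomial (Fin (n + 1)) K) :=
  Ideal.span {f | IsForm f ∧ ∀ p ∈ X, eval p.rep f = 0}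

/-- The homogeneous coordinate ring of `X`. -/
abbrev CoordRing {K : Type*} [Field K] {n : ℕ} (X : Set (PSpace K n)) : Type _ :=
  MvPolynomial (Fin (n + 1)) K ⧸ homogeneousIdeal X

/-- The degree `t` graded piece of the homogeneous coordinate ring: the classes of the forms of
degree `t`. -/
def gradedPiece {K : Type*} [Field K] {n : ℕ} (X : Set (PSpace K n)) (t : ℕ) :
    Submodule K (CoordRing X) :=
  (homogeneousSubmodule (Fin (n + 1)) K t).map
    (Ideal.Quotient.mkₐ K (homogeneousIdeal X)).toLinearMap

/-- The Hilbert function of (the homogeneous coordinate ring of) `X`. -/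
def HF {K : Type*} [Field K] {n : ℕ} (X : Set (PSpace K n)) (t : ℕ) : ℕ :=
  Module.finrank K (gradedPiece X t)

/-- The Hilbert polynomial of `X`: the polynomial that agrees with the Hilbert function at all
large integers. -/
def hilbertPolynomial {K : Type*} [Field K] {n : ℕ} (X : Set (PSpace K n)) : Polynomial ℚ :=
  Classical.epsilon fun P : Polynomial ℚ => ∀ᶠ t : ℕ in atTop, (HF X t : ℚ) = P.eval (t : ℚ)

/-- The dimension of `X` as a topological space, with the Zariski topology. -/
def dim {K : Type*} [Field K] {n : ℕ} (X : Set (PSpace K n)) : WithBot ℕ∞ :=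
  topologicalKrullDim X

/-- The degree of `X`: `(dim X)!` times the leading coefficient of the Hilbert polynomial. -/
def degree {K : Type*} [Field K] {n : ℕ} (X : Set (PSpace K n)) : ℚ :=
  (((dim X).unbotD 0).toNat.factorial : ℚ) * (hilbertPolynomial X).leadingCoeff

/-- The Hadamard product of two subsets of projective space: the Zariski closure of the set of the
coordinatewise products `p ⋆ q` with `p ∈ X`, `q ∈ Y`, taken over the pairs for which `p ⋆ q` is
defined, i.e. for which the coordinatewise products are not all zero. -/
def hadamard {K : Type*} [Field K] {n : ℕ} (X Y : Set (PSpace K n)) : Set (PSpace K n) :=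
  closure {z | ∃ p ∈ X, ∃ q ∈ Y, ∃ h : p.rep * q.rep ≠ 0,
    z = Projectivization.mk K (p.rep * q.rep) h}

/-- The linear subspace of projective space given by a vector subspace `L`. -/
def linearSubspace {K : Type*} [Field K] {n : ℕ} (L : Submodule K (Fin (n + 1) → K)) :
    Set (PSpace K n) :=
  {p | p.submodule ≤ L}

/-- The column space of a matrix. -/
def colSpace {K : Type*} [Field K] {n m : ℕ} (A : Matrix (Fin (n + 1)) (Fin m) K) :
    Submodule K (Fin (n + 1) → K) :=
  Submodule.span K (Set.range A.col)

/-- `P L L'` holds for generic linear subspaces `L`, `L'` of projective `n`-space of dimensions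
`h` and `k`: there is a non-zero polynomial `F` in the coefficients of a pair of linear
parameterizations such that `P` holds for all pairs of such subspaces that are parameterized by
injective `A`, `B` with `F (A, B) ≠ 0`. Over an infinite field this says that `P` holds on a
non-empty Zariski open subset of the product of the two Grassmannians. -/
def ForGenericPair (K : Type*) [Field K] (n h k : ℕ)
    (P : Set (PSpace K n) → Set (PSpace K n) → Prop) : Prop :=
  ∃ F : MvPolynomial ((Fin (n + 1) × Fin (h + 1)) ⊕ (Fin (n + 1) × Fin (k + 1))) K, F ≠ 0 ∧
    ∀ (A : Matrix (Fin (n + 1)) (Fin (h + 1)) K) (B : Matrix (Fin (n + 1)) (Fin (k + 1)) K),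
      LinearIndependent K A.col → LinearIndependent K B.col →
      eval (Sum.elim (fun ij => A ij.1 ij.2) (fun ij => B ij.1 ij.2)) F ≠ 0 →
      P (linearSubspace (colSpace A)) (linearSubspace (colSpace B))

end HadamardProj

end

open MvPolynomial Filter

noncomputable section

namespace HadamardProj

/-! ### Rational polynomials: values at large integers -/

/-! On generic `L`, `L'` the coordinatewise product is the Segre map followed by an injective linear
map: if `p = A u` and `q = B v`, then the coordinates of `p * q` are linear forms in the `u_a v_b`,
and since `n + 1 ≥ (h + 1)(k + 1)` they generically determine all `u_a v_b`. Hence every `p_i q_j`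
is a linear form in `p * q` (`IsHadamardGeneric`). It suffices that one determinant is a non-zero
polynomial in the entries of `A` and `B` (`exists_polynomial_isHadamardGeneric`).

Then the functions `(p, q) ↦ F (p * q)` on `X × Y`, with `F` a form of degree `t`, are exactly the
span of the products `a(p) b(q)` of forms of degree `t`. This span is the tensor product of the two
graded pieces, so Hilbert functions multiply (`HF_hadamard`), and so do Hilbert polynomials. Degrees
of polynomials add and leading coefficients multiply, which gives the dimension and the degree; the
binomial coefficient comes from the factorials in the definition of degree.

This needs the topological dimension of a variety to be the degree of its Hilbert polynomial
(`dim_eq_natDegree`). That degree drops strictly along strict inclusions of homogeneous primes, and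
cutting by a variable produces a larger prime where it drops by exactly one. The Nullstellensatz
turns such primes into varieties. -/

theorem eventually_eval_pos {P : Polynomial ℚ} (hP : 0 < P.leadingCoeff) :
    ∀ᶠ t : ℕ in atTop, 0 < P.eval (t : ℚ) := by
  rcases Nat.eq_zero_or_pos P.natDegree with h | h
  · rw [Polynomial.eq_C_of_natDegree_eq_zero h] at hP ⊢
    rw [Polynomial.leadingCoeff_C] at hP
    simpa only [Polynomial.eval_C] using Eventually.of_forall fun _ => hP
  · exact ((P.tendsto_atTop_of_leadingCoeff_nonneg (Polynomial.natDegree_pos_iff_degree_pos.1 h)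
      hP.le).comp tendsto_natCast_atTop_atTop).eventually_gt_atTop 0

theorem leadingCoeff_nonneg_of_eventually {P : Polynomial ℚ}
    (hP : ∀ᶠ t : ℕ in atTop, 0 ≤ P.eval (t : ℚ)) : 0 ≤ P.leadingCoeff := by
  by_contra! h
  have h' : 0 < (-P).leadingCoeff := by simpa using h
  obtain ⟨t, h1, h2⟩ := (hP.and (eventually_eval_pos h')).exists
  simp at h2
  linarith

theorem degree_le_of_eventually_le {P R : Polynomial ℚ}
    (hP : ∀ᶠ t : ℕ in atTop, 0 ≤ P.eval (t : ℚ))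
    (hPR : ∀ᶠ t : ℕ in atTop, P.eval (t : ℚ) ≤ R.eval (t : ℚ)) : P.degree ≤ R.degree := by
  by_contra! h
  have hP0 : P ≠ 0 := by
    rintro rfl
    simp at h
  have hlc : 0 < (P - R).leadingCoeff := by
    rw [Polynomial.leadingCoeff_sub_of_degree_lt h]
    exact lt_of_le_of_ne (leadingCoeff_nonneg_of_eventually hP)
      (Ne.symm (Polynomial.leadingCoeff_ne_zero.2 hP0))
  obtain ⟨t, h1, h2⟩ := (hPR.and (eventually_eval_pos hlc)).exists
  simp at h2
  linarith

theorem eq_of_eventually_eval_eq {P Q : Polynomial ℚ}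
    (h : ∀ᶠ t : ℕ in atTop, P.eval (t : ℚ) = Q.eval (t : ℚ)) : P = Q := by
  obtain ⟨N, hN⟩ := eventually_atTop.1 h
  refine Polynomial.eq_of_infinite_eval_eq P Q
    (((Set.Ici_infinite N).image (Nat.cast_injective (R := ℚ)).injOn).mono ?_)
  rintro _ ⟨t, ht, rfl⟩
  exact hN t ht

/-- Bernoulli polynomials satisfy `B_{m+1}(X + 1) - B_{m+1}(X) = (m + 1) X^m`. Used to sum the first
difference of a Hilbert function. -/
theorem exists_taylor_one_sub_self (P : Polynomial ℚ) :
    ∃ Q : Polynomial ℚ, Polynomial.taylor 1 Q - Q = P := by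
  induction P using Polynomial.induction_on' with
  | add p q hp hq =>
    obtain ⟨a, rfl⟩ := hp
    obtain ⟨b, rfl⟩ := hq
    exact ⟨a + b, by rw [map_add]; ring⟩
  | monomial m c =>
    refine ⟨Polynomial.C (c / (m + 1)) * Polynomial.bernoulli (m + 1), ?_⟩
    have hb := Polynomial.bernoulli_comp_one_add_X (m + 1)
    rw [Polynomial.taylor_apply, Polynomial.mul_comp, Polynomial.C_comp, Polynomial.C_1,
      add_comm Polynomial.X, hb, ← Polynomial.C_mul_X_pow_eq_monomial]
    have : (Polynomial.C c : Polynomial ℚ) = Polynomial.C (c / (m + 1)) * Polynomial.C ((m : ℚ) + 1) := by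
      rw [← Polynomial.C_mul, div_mul_cancel₀]
      positivity
    rw [this]
    simp
    ring

theorem degree_taylor_sub_self_lt {P : Polynomial ℚ} (hP : P ≠ 0) (a : ℚ) :
    (Polynomial.taylor a P - P).degree < P.degree := by
  have := Polynomial.degree_sub_lt_left (p := Polynomial.taylor a P) (q := P) (by simp) (by simpa) (by simp)
  simpa using this

/-- The coefficient of `X^d` in `P(X + a)` is the `d`-th Hasse derivative of `P` at `a`, here a
polynomial of degree at most 1 whose constant term cancels. -/
theorem coeff_taylor_sub_self {P : Polynomial ℚ} {d : ℕ} (hd : P.natDegree = d + 1) (a : ℚ) :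
    (Polynomial.taylor a P - P).coeff d = (d + 1) * P.leadingCoeff * a := by
  have h : (Polynomial.hasseDeriv d P).natDegree ≤ 1 := by
    have := Polynomial.natDegree_hasseDeriv_le P d
    omega
  rw [Polynomial.coeff_sub, Polynomial.taylor_coeff,
    Polynomial.eval_eq_sum_range' (n := 2) (by omega)]
  simp [Finset.sum_range_succ, Polynomial.hasseDeriv_coeff, Polynomial.leadingCoeff, hd,
    add_comm 1 d]

/-! ### Hilbert functions of homogeneous ideals -/

section HilbertFunction

variable {K σ : Type*} [Field K]

/-- The degree `t` part of an ideal of a polynomial ring. -/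
def idealPiece (I : Ideal (MvPolynomial σ K)) (t : ℕ) : Submodule K (MvPolynomial σ K) :=
  I.restrictScalars K ⊓ homogeneousSubmodule σ K t

theorem mem_idealPiece {I : Ideal (MvPolynomial σ K)} {t : ℕ} {f : MvPolynomial σ K} :
    f ∈ idealPiece I t ↔ f ∈ I ∧ f.IsHomogeneous t := Iff.rfl

instance [Finite σ] (t : ℕ) : Module.Finite K (homogeneousSubmodule σ K t) :=
  Module.Finite.iff_fg.2 (homogeneousSubmodule_fg σ K t)

instance [Finite σ] (I : Ideal (MvPolynomial σ K)) (t : ℕ) : Module.Finite K (idealPiece I t) :=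
  Submodule.finiteDimensional_of_le (inf_le_right : _ ≤ homogeneousSubmodule σ K t)

/-- The Hilbert function of the quotient by `I`: the codimension of `I` in degree `t`. -/
def idealHF (I : Ideal (MvPolynomial σ K)) (t : ℕ) : ℚ :=
  Module.finrank K (homogeneousSubmodule σ K t) - Module.finrank K (idealPiece I t)

/-- `P` is the Hilbert polynomial of the quotient by `I`. -/
def IsHilbertPoly (I : Ideal (MvPolynomial σ K)) (P : Polynomial ℚ) : Prop :=
  ∀ᶠ t : ℕ in atTop, idealHF I t = P.eval (t : ℚ)

theorem idealHF_anti [Finite σ] {I J : Ideal (MvPolynomial σ K)} (h : I ≤ J) (t : ℕ) :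
    idealHF J t ≤ idealHF I t := by
  have h1 : idealPiece I t ≤ idealPiece J t := inf_le_inf_right _ h
  have h2 : (Module.finrank K (idealPiece I t) : ℚ) ≤ Module.finrank K (idealPiece J t) := by
    exact_mod_cast Submodule.finrank_mono h1
  unfold idealHF
  linarith

theorem idealHF_nonneg [Finite σ] (I : Ideal (MvPolynomial σ K)) (t : ℕ) : 0 ≤ idealHF I t := by
  have h1 : idealPiece I t ≤ homogeneousSubmodule σ K t := inf_le_right
  have h2 : (Module.finrank K (idealPiece I t) : ℚ) ≤
      Module.finrank K (homogeneousSubmodule σ K t) := by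
    exact_mod_cast Submodule.finrank_mono h1
  unfold idealHF
  linarith

theorem idealHF_eq_zero_of_le {I : Ideal (MvPolynomial σ K)} {t : ℕ}
    (h : ∀ f : MvPolynomial σ K, f.IsHomogeneous t → f ∈ I) : idealHF I t = 0 := by
  have : idealPiece I t = homogeneousSubmodule σ K t := inf_eq_right.2 fun f hf => h f hf
  rw [idealHF, this, sub_self]

theorem idealHF_pos [Finite σ] {I : Ideal (MvPolynomial σ K)} {t : ℕ} {f : MvPolynomial σ K}
    (hf : f.IsHomogeneous t) (hfI : f ∉ I) : 0 < idealHF I t := by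
  have h1 : idealPiece I t < homogeneousSubmodule σ K t :=
    lt_of_le_of_ne inf_le_right fun h => hfI (mem_idealPiece.1 (h ▸ hf : f ∈ idealPiece I t)).1
  have h2 : (Module.finrank K (idealPiece I t) : ℚ) <
      Module.finrank K (homogeneousSubmodule σ K t) := by
    exact_mod_cast Submodule.finrank_lt_finrank_of_lt h1
  unfold idealHF
  linarith

theorem IsHilbertPoly.unique {I : Ideal (MvPolynomial σ K)} {P Q : Polynomial ℚ}
    (hP : IsHilbertPoly I P) (hQ : IsHilbertPoly I Q) : P = Q :=
  eq_of_eventually_eval_eq (by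
    filter_upwards [hP, hQ] with t h1 h2
    rw [← h1, h2])

attribute [local instance] MvPolynomial.gradedAlgebra

/-- The ideal is homogeneous for the grading by degree. -/
abbrev IsHomog (I : Ideal (MvPolynomial σ K)) : Prop :=
  I.IsHomogeneous (homogeneousSubmodule σ K)

theorem isHomog_iff {I : Ideal (MvPolynomial σ K)} :
    IsHomog I ↔ ∀ f ∈ I, ∀ d, homogeneousComponent d f ∈ I := by
  refine ⟨fun h f hf d => homogeneousComponent_mem_of_mem h hf d, fun h d f hf => ?_⟩
  have := h f hf d
  rwa [← decomposition.decompose'_apply] at this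

theorem homogeneousComponent_mul_of_isHomogeneous {f : MvPolynomial σ K} {e : ℕ}
    (hf : f.IsHomogeneous e) (u : MvPolynomial σ K) (t : ℕ) :
    homogeneousComponent (t + e) (f * u) = f * homogeneousComponent t u := by
  classical
  conv_lhs => rw [← sum_homogeneousComponent u, Finset.mul_sum, map_sum]
  have h : ∀ i, homogeneousComponent (t + e) (f * homogeneousComponent i u) =
      if i = t then f * homogeneousComponent i u else 0 := by
    intro i
    rw [homogeneousComponent_of_mem (hf.mul (homogeneousComponent_isHomogeneous i u))]
    congr 1
    simp only [eq_iff_iff]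
    omega
  simp only [h]
  rw [Finset.sum_ite_eq' ]
  split_ifs with ht
  · rfl
  · rw [homogeneousComponent_eq_zero _ _ (by simpa using ht), mul_zero]

theorem isHomog_span_singleton {f : MvPolynomial σ K} {e : ℕ} (hf : f.IsHomogeneous e) :
    IsHomog (Ideal.span {f}) := by
  refine Ideal.homogeneous_span _ _ ?_
  rintro _ rfl
  exact ⟨e, hf⟩

theorem isHomog_colon {I : Ideal (MvPolynomial σ K)} (hI : IsHomog I) {f : MvPolynomial σ K}
    {e : ℕ} (hf : f.IsHomogeneous e) : IsHomog (I.colon {f}) := by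
  rw [isHomog_iff] at hI ⊢
  intro u hu d
  rw [Submodule.mem_colon_singleton, smul_eq_mul, mul_comm] at hu ⊢
  rw [← homogeneousComponent_mul_of_isHomogeneous hf]
  exact hI _ hu _

/-- Additivity of Hilbert functions along multiplication by a form `f`. -/
theorem idealHF_add [Finite σ] {I : Ideal (MvPolynomial σ K)} (hI : IsHomog I) {f : MvPolynomial σ K}
    (hf0 : f ≠ 0) {e : ℕ} (hf : f.IsHomogeneous e) (t : ℕ) :
    idealHF I (t + e) = idealHF (I.colon {f}) t + idealHF (I ⊔ Ideal.span {f}) (t + e) := by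
  have hinj : Function.Injective (LinearMap.mulLeft K f) := fun a b hab => mul_left_cancel₀ hf0 hab
  -- The dimension formula for the sum and intersection of `I_{t+e}` and `f S_t` amounts to the
  -- exact sequence `0 → S/(I : f)(-e) → S/I → S/(I + (f)) → 0`.
  have hsup : idealPiece I (t + e) ⊔ (homogeneousSubmodule σ K t).map (LinearMap.mulLeft K f) =
      idealPiece (I ⊔ Ideal.span {f}) (t + e) := by
    apply le_antisymm
    · refine sup_le (inf_le_inf_right _ (fun x hx => Ideal.mem_sup_left hx)) ?_
      rintro _ ⟨u, hu, rfl⟩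
      refine ⟨Ideal.mem_sup_right (Ideal.mem_span_singleton.2 ⟨u, rfl⟩), ?_⟩
      rw [add_comm t e]
      exact hf.mul hu
    · rintro a ⟨ha, hat⟩
      obtain ⟨i, hi, y, hy, rfl⟩ := Submodule.mem_sup.1 ha
      obtain ⟨u, rfl⟩ := Ideal.mem_span_singleton.1 hy
      rw [← homogeneousComponent_eq_self hat, map_add,
        homogeneousComponent_mul_of_isHomogeneous hf]
      exact Submodule.add_mem_sup
        ⟨isHomog_iff.1 hI _ hi _, homogeneousComponent_isHomogeneous _ _⟩
        ⟨_, homogeneousComponent_isHomogeneous _ _, rfl⟩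
  have hinf : idealPiece I (t + e) ⊓ (homogeneousSubmodule σ K t).map (LinearMap.mulLeft K f) =
      (idealPiece (I.colon {f}) t).map (LinearMap.mulLeft K f) := by
    ext a
    constructor
    · rintro ⟨⟨ha, -⟩, u, hu, rfl⟩
      refine ⟨u, ⟨?_, hu⟩, rfl⟩
      change u ∈ I.colon {f}
      rw [Submodule.mem_colon_singleton, smul_eq_mul, mul_comm]
      exact ha
    · rintro ⟨u, ⟨hu, hut⟩, rfl⟩
      change u ∈ I.colon {f} at hu
      rw [Submodule.mem_colon_singleton, smul_eq_mul, mul_comm] at hu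
      refine ⟨⟨hu, ?_⟩, u, hut, rfl⟩
      rw [add_comm t e]
      exact hf.mul hut
  have key := Submodule.finrank_sup_add_finrank_inf_eq (idealPiece I (t + e))
    ((homogeneousSubmodule σ K t).map (LinearMap.mulLeft K f))
  rw [hsup, hinf, ← (Submodule.equivMapOfInjective _ hinj _).finrank_eq,
    ← (Submodule.equivMapOfInjective _ hinj _).finrank_eq] at key
  have key' : (Module.finrank K (idealPiece (I ⊔ Ideal.span {f}) (t + e)) : ℚ) +
      Module.finrank K (idealPiece (I.colon {f}) t) = Module.finrank K (idealPiece I (t + e)) +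
      Module.finrank K (homogeneousSubmodule σ K t) := by exact_mod_cast key
  unfold idealHF
  linarith

end HilbertFunction

/-! ### Existence and degree of Hilbert polynomials. -/

section HilbertPolynomial

variable {K σ : Type*} [Field K]

attribute [local instance] MvPolynomial.gradedAlgebra

theorem isHilbertPoly_zero_of_forall_X_mem {I : Ideal (MvPolynomial σ K)}
    (h : ∀ i, (X i : MvPolynomial σ K) ∈ I) : IsHilbertPoly I 0 := by
  filter_upwards [eventually_ge_atTop 1] with t ht
  rw [Polynomial.eval_zero]
  refine idealHF_eq_zero_of_le fun f hf => ?_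
  rw [f.as_sum]
  refine sum_mem fun m hm => ?_
  have hm' : m.degree = t := by
    by_contra hne
    exact (mem_support_iff.1 hm) (hf.coeff_eq_zero hne)
  obtain ⟨i, hi⟩ : ∃ i, m i ≠ 0 := by
    by_contra! hcon
    have : m = 0 := Finsupp.ext hcon
    rw [this, map_zero] at hm'
    omega
  exact I.mem_of_dvd (X_dvd_monomial.2 (Or.inr hi)) (h i)

theorem colon_eq_self_of_notMem {I : Ideal (MvPolynomial σ K)} [hI : I.IsPrime]
    {f : MvPolynomial σ K} (hf : f ∉ I) : I.colon {f} = I := by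
  ext u
  rw [Submodule.mem_colon_singleton, smul_eq_mul]
  exact ⟨fun h => (hI.mem_or_mem h).resolve_right hf, fun h => I.mul_mem_right _ h⟩

/-- Here `(I : f) = I`, so additivity reads `HF_{I+(f)}(t) = HF_I(t) - HF_I(t - e)`. -/
theorem IsHilbertPoly.sup_span_of_isPrime [Finite σ] {I : Ideal (MvPolynomial σ K)} [I.IsPrime]
    (hI : IsHomog I) {f : MvPolynomial σ K} (hfI : f ∉ I) {e : ℕ} (hf : f.IsHomogeneous e)
    {P : Polynomial ℚ} (hP : IsHilbertPoly I P) :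
    IsHilbertPoly (I ⊔ Ideal.span {f}) (P - Polynomial.taylor (-e : ℚ) P) := by
  have hf0 : f ≠ 0 := fun h => hfI (h ▸ I.zero_mem)
  have h2 := (tendsto_sub_atTop_nat e).eventually hP
  filter_upwards [hP, h2, eventually_ge_atTop e] with t h1 h2 ht
  have := idealHF_add hI hf0 hf (t - e)
  rw [colon_eq_self_of_notMem hfI, Nat.sub_add_cancel ht, h1, h2] at this
  rw [Polynomial.eval_sub, Polynomial.taylor_eval, this, Nat.cast_sub ht]
  ring_nf

/-- Hilbert polynomials exist, and the degree of the Hilbert polynomial of a homogeneous ideal is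
attained by a homogeneous prime containing it. -/
theorem exists_isHilbertPoly [Finite σ] (I : Ideal (MvPolynomial σ K)) (hI : IsHomog I) :
    ∃ P : Polynomial ℚ, IsHilbertPoly I P ∧ (P = 0 ∨
      ∃ Q : Ideal (MvPolynomial σ K), I ≤ Q ∧ Q.IsPrime ∧ IsHomog Q ∧
        ∃ R : Polynomial ℚ, IsHilbertPoly Q R ∧ P.degree ≤ R.degree) := by
  induction I using WellFoundedGT.induction with
  | ind I ih =>
  by_cases htop : I = ⊤
  · exact ⟨0, isHilbertPoly_zero_of_forall_X_mem (by simp [htop]), Or.inl rfl⟩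
  by_cases hprime : I.IsPrime
  · suffices h : ∃ P : Polynomial ℚ, IsHilbertPoly I P by
      obtain ⟨P, hP⟩ := h
      exact ⟨P, hP, Or.inr ⟨I, le_rfl, hprime, hI, P, hP, le_rfl⟩⟩
    by_cases hX : ∀ i, (X i : MvPolynomial σ K) ∈ I
    · exact ⟨0, isHilbertPoly_zero_of_forall_X_mem hX⟩
    push Not at hX
    obtain ⟨i, hi⟩ := hX
    have hlt : I < I ⊔ Ideal.span {X i} := by
      refine lt_of_le_of_ne le_sup_left fun h => hi ?_
      rw [h]
      exact Ideal.mem_sup_right (Ideal.mem_span_singleton_self _)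
    obtain ⟨P', hP', -⟩ := ih _ hlt (hI.sup (isHomog_span_singleton (isHomogeneous_X K i)))
    -- Since `HF_I(t + 1) - HF_I(t) = P'(t + 1)` for large `t`, the shifted `P'` has to be summed;
    -- the constant is then fixed by the value at `N`.
    obtain ⟨Q, hQ⟩ := exists_taylor_one_sub_self (Polynomial.taylor 1 P')
    obtain ⟨N, hN⟩ := eventually_atTop.1 hP'
    refine ⟨Q + Polynomial.C (idealHF I N - Q.eval (N : ℚ)), ?_⟩
    filter_upwards [eventually_ge_atTop N] with t ht
    induction t, ht using Nat.le_induction with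
    | base => simp
    | succ t ht iht =>
      have h1 := idealHF_add hI (X_ne_zero i) (isHomogeneous_X K i) t
      rw [colon_eq_self_of_notMem hi, iht, hN (t + 1) (by omega)] at h1
      have h2 := congrArg (Polynomial.eval (t : ℚ)) hQ
      simp only [Polynomial.eval_sub, Polynomial.taylor_eval] at h2
      rw [h1]
      simp only [Polynomial.eval_add, Polynomial.eval_C]
      push_cast
      linarith
  -- Primality of a homogeneous ideal can be tested on forms. The ideals `I + (f)` and `I : f`
  -- (which contains `g`) are strictly larger than `I`, and additivity combines their polynomials.
  · obtain ⟨f, g, ⟨e, hf⟩, ⟨e', hg⟩, hfg, hfI, hgI⟩ : ∃ f g : MvPolynomial σ K,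
        SetLike.IsHomogeneousElem (homogeneousSubmodule σ K) f ∧
        SetLike.IsHomogeneousElem (homogeneousSubmodule σ K) g ∧ f * g ∈ I ∧ f ∉ I ∧ g ∉ I := by
      by_contra! hcon
      refine hprime (hI.isPrime_of_homogeneous_mem_or_mem htop fun {x y} hx hy hxy => ?_)
      by_contra! h
      exact h.2 (hcon x y hx hy hxy h.1)
    have hf0 : f ≠ 0 := fun h => hfI (h ▸ I.zero_mem)
    have hlt1 : I < I ⊔ Ideal.span {f} := by
      refine lt_of_le_of_ne le_sup_left fun h => hfI ?_
      rw [h]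
      exact Ideal.mem_sup_right (Ideal.mem_span_singleton_self _)
    have hlt2 : I < I.colon {f} := by
      refine lt_of_le_of_ne (fun u hu => ?_) fun h => hgI ?_
      · rw [Submodule.mem_colon_singleton]
        exact I.mul_mem_right _ hu
      · rw [h, Submodule.mem_colon_singleton, smul_eq_mul, mul_comm]
        exact hfg
    obtain ⟨P₁, hP₁, hQ₁⟩ := ih _ hlt1 (hI.sup (isHomog_span_singleton hf))
    obtain ⟨P₂, hP₂, hQ₂⟩ := ih _ hlt2 (isHomog_colon hI hf)
    refine ⟨Polynomial.taylor (-e : ℚ) P₂ + P₁, ?_, ?_⟩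
    · have h2 := (tendsto_sub_atTop_nat e).eventually hP₂
      filter_upwards [hP₁, h2, eventually_ge_atTop e] with t h1 h2 ht
      have := idealHF_add hI hf0 hf (t - e)
      rw [Nat.sub_add_cancel ht, h1, h2] at this
      rw [Polynomial.eval_add, Polynomial.taylor_eval, this, Nat.cast_sub ht]
      ring_nf
    -- The degree of the sum is at most the larger of the two, so the prime for that summand serves
    -- for `I` as well.
    · have hdeg := Polynomial.degree_add_le (Polynomial.taylor (-e : ℚ) P₂) P₁
      rw [Polynomial.degree_taylor] at hdeg
      by_cases h0 : Polynomial.taylor (-e : ℚ) P₂ + P₁ = 0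
      · exact Or.inl h0
      have hbot := Polynomial.degree_ne_bot.2 h0
      rcases le_max_iff.1 hdeg with h | h
      · rcases hQ₂ with rfl | ⟨Q, hIQ, hQ, hQh, R, hR, hRd⟩
        · exact absurd (le_bot_iff.1 (by simpa using h)) hbot
        · exact Or.inr ⟨Q, hlt2.le.trans hIQ, hQ, hQh, R, hR, h.trans hRd⟩
      · rcases hQ₁ with rfl | ⟨Q, hIQ, hQ, hQh, R, hR, hRd⟩
        · exact absurd (le_bot_iff.1 (by simpa using h)) hbot
        · exact Or.inr ⟨Q, hlt1.le.trans hIQ, hQ, hQh, R, hR, h.trans hRd⟩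

theorem IsHilbertPoly.ne_zero [Finite σ] {I : Ideal (MvPolynomial σ K)} [hI : I.IsPrime] {i : σ}
    (hi : (X i : MvPolynomial σ K) ∉ I) {P : Polynomial ℚ} (hP : IsHilbertPoly I P) : P ≠ 0 := by
  rintro rfl
  obtain ⟨t, ht⟩ := hP.exists
  have := idealHF_pos (isHomogeneous_X_pow (R := K) i t) fun h => hi (hI.mem_of_pow_mem _ h)
  rw [ht, Polynomial.eval_zero] at this
  exact lt_irrefl _ this

theorem IsHilbertPoly.eventually_nonneg [Finite σ] {I : Ideal (MvPolynomial σ K)}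
    {P : Polynomial ℚ} (hP : IsHilbertPoly I P) : ∀ᶠ t : ℕ in atTop, 0 ≤ P.eval (t : ℚ) := by
  filter_upwards [hP] with t ht
  rw [← ht]
  exact idealHF_nonneg I t

/-- The degree of the Hilbert polynomial drops along strict inclusions of homogeneous primes. -/
theorem IsHilbertPoly.degree_lt [Finite σ] {I J : Ideal (MvPolynomial σ K)} [I.IsPrime]
    (hI : IsHomog I) (hJ : IsHomog J) (hIJ : I < J) {P R : Polynomial ℚ}
    (hP : IsHilbertPoly I P) (hP0 : P ≠ 0) (hR : IsHilbertPoly J R) : R.degree < P.degree := by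
  obtain ⟨g, hgJ, hgI⟩ := SetLike.exists_of_lt hIJ
  obtain ⟨e, he⟩ : ∃ e, homogeneousComponent e g ∉ I := by
    by_contra! hcon
    exact hgI ((mem_iff_homogeneousComponent_mem hI g).2 hcon)
  -- The ideal `J` contains `I` and a form outside `I`, so its Hilbert polynomial is eventually
  -- bounded by a difference of `P`, of smaller degree.
  have h1 := hP.sup_span_of_isPrime hI he (homogeneousComponent_isHomogeneous e g)
  have h2 : I ⊔ Ideal.span {homogeneousComponent e g} ≤ J :=
    sup_le hIJ.le ((Ideal.span_singleton_le_iff_mem _).2 (isHomog_iff.1 hJ g hgJ e))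
  refine (degree_le_of_eventually_le hR.eventually_nonneg (R := P - Polynomial.taylor (-e : ℚ) P)
    ?_).trans_lt ?_
  · filter_upwards [hR, h1] with t h3 h4
    rw [← h3, ← h4]
    exact idealHF_anti h2 t
  · rw [← Polynomial.degree_neg, neg_sub]
    exact degree_taylor_sub_self_lt hP0 _

/-- If the Hilbert polynomial of a homogeneous prime has degree `d + 1`, there is a larger
homogeneous prime, not containing all variables, whose Hilbert polynomial has degree `d`. -/
theorem exists_isPrime_natDegree_eq [Finite σ] {I : Ideal (MvPolynomial σ K)} [I.IsPrime]
    (hI : IsHomog I) {P : Polynomial ℚ} (hP : IsHilbertPoly I P) {d : ℕ}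
    (hd : P.natDegree = d + 1) :
    ∃ Q : Ideal (MvPolynomial σ K), I < Q ∧ Q.IsPrime ∧ IsHomog Q ∧
      (∃ i, (X i : MvPolynomial σ K) ∉ Q) ∧
      ∃ R : Polynomial ℚ, IsHilbertPoly Q R ∧ R.natDegree = d := by
  have hP0 : P ≠ 0 := by
    rintro rfl
    simp at hd
  obtain ⟨i, hi⟩ : ∃ i, (X i : MvPolynomial σ K) ∉ I := by
    by_contra! hcon
    exact hP0 (hP.unique (isHilbertPoly_zero_of_forall_X_mem hcon))
  have h1 := hP.sup_span_of_isPrime hI hi (isHomogeneous_X K i)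
  obtain ⟨P', hP', hQ⟩ := exists_isHilbertPoly _
    (hI.sup (isHomog_span_singleton (isHomogeneous_X K i)))
  obtain rfl := hP'.unique h1
  set D := P - Polynomial.taylor (-((1 : ℕ) : ℚ)) P with hD
  -- As `D` has degree at least `d`, so does the polynomial of the prime `Q` over `I + (X i)`; being
  -- smaller than `d + 1` by `IsHilbertPoly.degree_lt`, it is `d`.
  have hcoeff : D.coeff d ≠ 0 := by
    rw [hD, ← neg_sub, Polynomial.coeff_neg, coeff_taylor_sub_self hd]
    have := Polynomial.leadingCoeff_ne_zero.2 hP0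
    have : (d : ℚ) + 1 ≠ 0 := by positivity
    simp [*]
  have hDd : (d : WithBot ℕ) ≤ D.degree := Polynomial.le_degree_of_ne_zero hcoeff
  rcases hQ with h0 | ⟨Q, hIQ, hQ, hQh, R, hR, hRd⟩
  · simp [h0] at hcoeff
  have hIQ' : I < Q := lt_of_lt_of_le (lt_of_le_of_ne le_sup_left fun h => hi (by
    rw [h]
    exact Ideal.mem_sup_right (Ideal.mem_span_singleton_self _))) hIQ
  have hR0 : R ≠ 0 := by
    rintro rfl
    have := hDd.trans hRd
    simp at this
  refine ⟨Q, hIQ', hQ, hQh, ?_, R, hR, ?_⟩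
  -- A prime containing all variables would have Hilbert polynomial `0`; non-vanishing of `R`
  -- excludes this even for `d = 0`.
  · by_contra! hcon
    exact hR0 (hR.unique (isHilbertPoly_zero_of_forall_X_mem hcon))
  · have h3 := hP.degree_lt hI hQh hIQ' hP0 hR
    rw [Polynomial.degree_eq_natDegree hP0, Polynomial.degree_eq_natDegree hR0, hd] at h3
    have h4 := hDd.trans hRd
    rw [Polynomial.degree_eq_natDegree hR0] at h4
    norm_cast at h3 h4
    omega

end HilbertPolynomial

/-! ### Closed subsets of projective space and homogeneous ideals -/

section Projective

variable {K : Type*} [Field K] {n : ℕ}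

attribute [local instance] MvPolynomial.gradedAlgebra

theorem eval_smul_of_isHomogeneous {σ : Type*} {f : MvPolynomial σ K} {d : ℕ}
    (hf : f.IsHomogeneous d) (c : K) (x : σ → K) : eval (c • x) f = c ^ d * eval x f := by
  rw [eval_eq, eval_eq, Finset.mul_sum]
  refine Finset.sum_congr rfl fun m hm => ?_
  have hm' : m.degree = d := by
    by_contra hne
    exact (mem_support_iff.1 hm) (hf.coeff_eq_zero hne)
  simp only [Pi.smul_apply, smul_eq_mul, mul_pow, Finset.prod_mul_distrib]
  rw [Finset.prod_pow_eq_pow_sum, ← hm', Finsupp.degree_apply]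
  ring

theorem eval_mk_rep_eq_zero_iff {f : MvPolynomial (Fin (n + 1)) K} (hf : IsForm f)
    {v : Fin (n + 1) → K} (hv : v ≠ 0) :
    eval (Projectivization.mk K v hv).rep f = 0 ↔ eval v f = 0 := by
  obtain ⟨d, hf⟩ := hf
  obtain ⟨a, ha⟩ := Projectivization.exists_smul_eq_mk_rep K v hv
  rw [← ha, Units.smul_def, eval_smul_of_isHomogeneous hf]
  simp

theorem isClosed_iff {Z : Set (PSpace K n)} :
    IsClosed Z ↔ ∃ T : Set (MvPolynomial (Fin (n + 1)) K), (∀ f ∈ T, IsForm f) ∧ Z = zeros T := by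
  rw [← isOpen_compl_iff]
  change Zᶜᶜ ∈ _ ↔ _
  rw [compl_compl]
  rfl

theorem isClosed_zeros {T : Set (MvPolynomial (Fin (n + 1)) K)} (hT : ∀ f ∈ T, IsForm f) :
    IsClosed (zeros T) := isClosed_iff.2 ⟨T, hT, rfl⟩

theorem eval_eq_zero_of_mem_homogeneousIdeal {X : Set (PSpace K n)}
    {f : MvPolynomial (Fin (n + 1)) K} (hf : f ∈ homogeneousIdeal X) {p : PSpace K n}
    (hp : p ∈ X) : eval p.rep f = 0 := by
  have : homogeneousIdeal X ≤ RingHom.ker (eval p.rep) :=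
    Ideal.span_le.2 fun g hg => hg.2 p hp
  exact this hf

theorem mem_homogeneousIdeal_iff {X : Set (PSpace K n)} {f : MvPolynomial (Fin (n + 1)) K}
    (hf : IsForm f) : f ∈ homogeneousIdeal X ↔ ∀ p ∈ X, eval p.rep f = 0 :=
  ⟨fun h _ hp => eval_eq_zero_of_mem_homogeneousIdeal h hp, fun h => Ideal.subset_span ⟨hf, h⟩⟩

theorem isHomog_homogeneousIdeal (X : Set (PSpace K n)) : IsHomog (homogeneousIdeal X) :=
  Ideal.homogeneous_span _ _ fun _ hf => hf.1

theorem homogeneousIdeal_anti {X Y : Set (PSpace K n)} (h : X ⊆ Y) :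
    homogeneousIdeal Y ≤ homogeneousIdeal X :=
  Ideal.span_mono fun _ hf => ⟨hf.1, fun p hp => hf.2 p (h hp)⟩

theorem homogeneousIdeal_closure (X : Set (PSpace K n)) :
    homogeneousIdeal (closure X) = homogeneousIdeal X := by
  refine le_antisymm (homogeneousIdeal_anti subset_closure) (Ideal.span_le.2 ?_)
  rintro f ⟨hf, hfX⟩
  refine (mem_homogeneousIdeal_iff hf).2 fun p hp => ?_
  have h : closure X ⊆ zeros {f} :=
    closure_minimal (fun q hq g hg => by rw [hg]; exact hfX q hq)
      (isClosed_zeros (by rintro _ rfl; exact hf))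
  exact h hp f rfl

theorem subset_of_homogeneousIdeal_le {X Y : Set (PSpace K n)} (hY : IsClosed Y)
    (h : homogeneousIdeal Y ≤ homogeneousIdeal X) : X ⊆ Y := by
  obtain ⟨T, hT, rfl⟩ := isClosed_iff.1 hY
  intro p hp f hf
  refine eval_eq_zero_of_mem_homogeneousIdeal (h ?_) hp
  exact (mem_homogeneousIdeal_iff (hT f hf)).2 fun q hq => hq f hf

theorem exists_X_notMem_homogeneousIdeal {X : Set (PSpace K n)} (hX : X.Nonempty) :
    ∃ i, (MvPolynomial.X i : MvPolynomial (Fin (n + 1)) K) ∉ homogeneousIdeal X := by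
  obtain ⟨p, hp⟩ := hX
  obtain ⟨i, hi⟩ := Function.ne_iff.1 p.rep_nonzero
  refine ⟨i, fun h => hi ?_⟩
  simpa using eval_eq_zero_of_mem_homogeneousIdeal h hp

/-- If `X` is in neither of two closed sets, one form from each already detects this. -/
theorem isIrreducible_of_forall_isForm {X : Set (PSpace K n)} (hX : X.Nonempty)
    (h : ∀ f g : MvPolynomial (Fin (n + 1)) K, IsForm f → IsForm g →
      (∀ p ∈ X, eval p.rep f = 0 ∨ eval p.rep g = 0) →
      (∀ p ∈ X, eval p.rep f = 0) ∨ ∀ p ∈ X, eval p.rep g = 0) : IsIrreducible X := by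
  refine ⟨hX, isPreirreducible_iff_isClosed_union_isClosed.2 fun Z₁ Z₂ h₁ h₂ hXZ => ?_⟩
  obtain ⟨T₁, hT₁, rfl⟩ := isClosed_iff.1 h₁
  obtain ⟨T₂, hT₂, rfl⟩ := isClosed_iff.1 h₂
  by_contra! hcon
  obtain ⟨⟨p, hp, hp1⟩, q, hq, hq2⟩ := hcon.imp Set.not_subset.1 Set.not_subset.1
  simp only [zeros, Set.mem_ofPred_eq, not_forall] at hp1 hq2
  obtain ⟨f, hf, hfp⟩ := hp1
  obtain ⟨g, hg, hgq⟩ := hq2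
  rcases h f g (hT₁ f hf) (hT₂ g hg) (fun x hx => (hXZ hx).imp (· f hf) (· g hg)) with h | h
  · exact hfp (h p hp)
  · exact hgq (h q hq)

theorem forall_eval_eq_zero_or_of_isIrreducible {X : Set (PSpace K n)} (hX : IsIrreducible X)
    {T₁ T₂ : Set (MvPolynomial (Fin (n + 1)) K)} (hT₁ : ∀ f ∈ T₁, IsForm f)
    (hT₂ : ∀ f ∈ T₂, IsForm f)
    (h : ∀ p ∈ X, (∀ f ∈ T₁, eval p.rep f = 0) ∨ ∀ f ∈ T₂, eval p.rep f = 0) :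
    (∀ p ∈ X, ∀ f ∈ T₁, eval p.rep f = 0) ∨ ∀ p ∈ X, ∀ f ∈ T₂, eval p.rep f = 0 :=
  isPreirreducible_iff_isClosed_union_isClosed.1 hX.2 (zeros T₁) (zeros T₂)
    (isClosed_zeros hT₁) (isClosed_zeros hT₂) h

theorem isPrime_homogeneousIdeal {X : Set (PSpace K n)} (hX : IsIrreducible X) :
    (homogeneousIdeal X).IsPrime := by
  refine (isHomog_homogeneousIdeal X).isPrime_of_homogeneous_mem_or_mem ?_ ?_
  · intro h
    obtain ⟨i, hi⟩ := exists_X_notMem_homogeneousIdeal hX.1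
    exact hi (h ▸ Submodule.mem_top)
  · intro f g hf hg hfg
    have hf' : IsForm f := hf
    have hg' : IsForm g := hg
    rw [mem_homogeneousIdeal_iff hf', mem_homogeneousIdeal_iff hg']
    have := forall_eval_eq_zero_or_of_isIrreducible hX (T₁ := {f}) (T₂ := {g})
      (by rintro _ rfl; exact hf') (by rintro _ rfl; exact hg') fun p hp => by
        simpa using eval_eq_zero_of_mem_homogeneousIdeal hfg hp
    simpa using this

/-- The projective Nullstellensatz for homogeneous primes. -/
theorem homogeneousIdeal_zeros_of_isPrime [IsAlgClosed K]
    {Q : Ideal (MvPolynomial (Fin (n + 1)) K)} [hQ : Q.IsPrime] (hQh : IsHomog Q)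
    (hX : ∃ i, (MvPolynomial.X i : MvPolynomial (Fin (n + 1)) K) ∉ Q) :
    (zeros {f | f ∈ Q ∧ IsForm f}).Nonempty ∧ homogeneousIdeal (zeros {f | f ∈ Q ∧ IsForm f}) = Q := by
  set Z := zeros {f | f ∈ Q ∧ IsForm f} with hZ
  have hmem : ∀ (v : Fin (n + 1) → K) (hv : v ≠ 0), v ∈ zeroLocus K Q →
      Projectivization.mk K v hv ∈ Z := fun v hv hvQ f hf =>
    (eval_mk_rep_eq_zero_iff hf.2 hv).2 (by simpa [aeval_eq_eval] using hvQ f hf.1)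
  have hnull : ∀ f : MvPolynomial (Fin (n + 1)) K, (∀ v ∈ zeroLocus K Q, eval v f = 0) → f ∈ Q := by
    intro f hf
    rw [← IsPrime.vanishingIdeal_zeroLocus (K := K) Q]
    intro v hv
    simpa [aeval_eq_eval] using hf v hv
  -- Were `Z` empty, the affine zero locus of `Q` would lie in the origin, where all variables
  -- vanish, and `Q` would contain them.
  have hne : Z.Nonempty := by
    obtain ⟨i, hi⟩ := hX
    by_contra hcon
    refine hi (hnull _ fun v hv => ?_)
    by_contra hv0
    refine hcon ⟨_, hmem v (fun h => hv0 (by simp [h])) hv⟩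
  refine ⟨hne, le_antisymm (Ideal.span_le.2 ?_) ?_⟩
  · rintro f ⟨⟨d, hf⟩, hfZ⟩
    refine hnull f fun v hv => ?_
    -- The origin is no projective point: there a form of positive degree vanishes, and a constant
    -- vanishes because it does so at a point of `Z`.
    by_cases hv0 : v = 0
    · rcases Nat.eq_zero_or_pos d with rfl | hd
      · obtain ⟨p, hp⟩ := hne
        have h1 := eval_smul_of_isHomogeneous hf 0 p.rep
        rw [hfZ p hp, zero_smul, mul_zero] at h1
        rw [hv0, h1]
      · have h1 := eval_smul_of_isHomogeneous hf 0 v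
        rw [zero_smul, zero_pow hd.ne', zero_mul] at h1
        rw [hv0, h1]
    · exact (eval_mk_rep_eq_zero_iff ⟨d, hf⟩ hv0).1 (hfZ _ (hmem v hv0 hv))
  · intro f hf
    rw [← sum_homogeneousComponent f]
    refine sum_mem fun d _ => ?_
    have hform : IsForm (homogeneousComponent d f) := ⟨d, homogeneousComponent_isHomogeneous d f⟩
    exact (mem_homogeneousIdeal_iff hform).2 fun p hp => hp _ ⟨isHomog_iff.1 hQh f hf d, hform⟩

theorem isIrreducible_zeros_of_isPrime [IsAlgClosed K]
    {Q : Ideal (MvPolynomial (Fin (n + 1)) K)} [hQ : Q.IsPrime] (hQh : IsHomog Q)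
    (hX : ∃ i, (MvPolynomial.X i : MvPolynomial (Fin (n + 1)) K) ∉ Q) :
    IsIrreducible (zeros {f | f ∈ Q ∧ IsForm f}) := by
  obtain ⟨hne, hI⟩ := homogeneousIdeal_zeros_of_isPrime hQh hX
  refine isIrreducible_of_forall_isForm hne fun f g hf hg hfg => ?_
  rw [← mem_homogeneousIdeal_iff hf, ← mem_homogeneousIdeal_iff hg, hI]
  refine hQ.mem_or_mem ?_
  rw [← hI]
  obtain ⟨d, hd⟩ := hf
  obtain ⟨e, he⟩ := hg
  exact (mem_homogeneousIdeal_iff ⟨d + e, hd.mul he⟩).2 fun p hp => by simpa using hfg p hp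

/-! ### Dimension and Hilbert polynomial -/

/-- Rank-nullity with kernel `I_t`. It lets the Hilbert function be computed from the quotient map
or from evaluation at points. -/
theorem finrank_range_eq_idealHF {σ M : Type*} [Finite σ] [AddCommGroup M] [Module K M] {t : ℕ}
    {I : Ideal (MvPolynomial σ K)} (φ : homogeneousSubmodule σ K t →ₗ[K] M)
    (hφ : ∀ f, φ f = 0 ↔ (f : MvPolynomial σ K) ∈ I) :
    (Module.finrank K (LinearMap.range φ) : ℚ) = idealHF I t := by
  have h1 := LinearMap.finrank_range_add_finrank_ker φ
  have h2 : (LinearMap.ker φ).map (homogeneousSubmodule σ K t).subtype = idealPiece I t := by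
    ext f
    constructor
    · rintro ⟨g, hgk, rfl⟩
      exact ⟨(hφ g).1 hgk, g.2⟩
    · rintro ⟨hf, hft⟩
      exact ⟨⟨f, hft⟩, (hφ _).2 hf, rfl⟩
  rw [(Submodule.equivMapOfInjective _ (Submodule.injective_subtype _) _).finrank_eq, h2] at h1
  rw [idealHF, ← h1]
  push_cast
  ring

theorem HF_eq_idealHF (X : Set (PSpace K n)) (t : ℕ) :
    (HF X t : ℚ) = idealHF (homogeneousIdeal X) t := by
  rw [← finrank_range_eq_idealHF ((Ideal.Quotient.mkₐ K
    (homogeneousIdeal X)).toLinearMap.domRestrict (homogeneousSubmodule (Fin (n + 1)) K t))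
    fun f => Ideal.Quotient.eq_zero_iff_mem, LinearMap.range_domRestrict]
  rfl

theorem isHilbertPoly_homogeneousIdeal_iff {X : Set (PSpace K n)} {P : Polynomial ℚ} :
    IsHilbertPoly (homogeneousIdeal X) P ↔ ∀ᶠ t : ℕ in atTop, (HF X t : ℚ) = P.eval (t : ℚ) := by
  simp only [IsHilbertPoly, HF_eq_idealHF]

theorem isHilbertPoly_hilbertPolynomial (X : Set (PSpace K n)) :
    IsHilbertPoly (homogeneousIdeal X) (hilbertPolynomial X) := by
  obtain ⟨P, hP, -⟩ := exists_isHilbertPoly _ (isHomog_homogeneousIdeal X)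
  rw [isHilbertPoly_homogeneousIdeal_iff] at hP ⊢
  exact Classical.epsilon_spec (p := fun P : Polynomial ℚ =>
    ∀ᶠ t : ℕ in atTop, (HF X t : ℚ) = P.eval (t : ℚ)) ⟨P, hP⟩

theorem hilbertPolynomial_ne_zero {X : Set (PSpace K n)} (hX : IsIrreducible X) :
    hilbertPolynomial X ≠ 0 := by
  have := isPrime_homogeneousIdeal hX
  obtain ⟨i, hi⟩ := exists_X_notMem_homogeneousIdeal hX.1
  exact (isHilbertPoly_hilbertPolynomial X).ne_zero hi

open TopologicalSpace in
theorem natDegree_hilbertPolynomial_strictMono :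
    StrictMono fun Z : IrreducibleCloseds (PSpace K n) =>
      (hilbertPolynomial (Z : Set (PSpace K n))).natDegree := by
  intro Z W hZW
  have := isPrime_homogeneousIdeal W.isIrreducible
  have hlt : homogeneousIdeal (W : Set (PSpace K n)) < homogeneousIdeal (Z : Set (PSpace K n)) := by
    refine lt_of_le_not_ge (homogeneousIdeal_anti hZW.le) fun h => ?_
    exact hZW.not_ge (subset_of_homogeneousIdeal_le Z.isClosed h)
  exact Polynomial.natDegree_lt_natDegree (hilbertPolynomial_ne_zero Z.isIrreducible)
    ((isHilbertPoly_hilbertPolynomial _).degree_lt (isHomog_homogeneousIdeal _)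
      (isHomog_homogeneousIdeal _) hlt (hilbertPolynomial_ne_zero W.isIrreducible)
      (isHilbertPoly_hilbertPolynomial _))

open TopologicalSpace in
-- Strict monotonicity of the degree bounds chains from above; descending one degree at a time
-- through `exists_isPrime_natDegree_eq` and the Nullstellensatz builds a chain of full length.
theorem height_eq_natDegree [IsAlgClosed K] (Z : IrreducibleCloseds (PSpace K n)) :
    Order.height Z = (hilbertPolynomial (Z : Set (PSpace K n))).natDegree := by
  apply le_antisymm
  · have := Order.height_le_height_apply_of_strictMono _
      (natDegree_hilbertPolynomial_strictMono (K := K) (n := n)) Z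
    rwa [Order.height_nat] at this
  · generalize hd : (hilbertPolynomial (Z : Set (PSpace K n))).natDegree = d
    induction d generalizing Z with
    | zero => simp
    | succ d ih =>
      have := isPrime_homogeneousIdeal Z.isIrreducible
      obtain ⟨Q, hIQ, hQ, hQh, hX, R, hR, hRd⟩ := exists_isPrime_natDegree_eq
        (isHomog_homogeneousIdeal _) (isHilbertPoly_hilbertPolynomial (Z : Set (PSpace K n))) hd
      obtain ⟨-, hI⟩ := homogeneousIdeal_zeros_of_isPrime hQh hX
      let W : IrreducibleCloseds (PSpace K n) :=
        ⟨zeros {f | f ∈ Q ∧ IsForm f}, isIrreducible_zeros_of_isPrime hQh hX,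
          isClosed_zeros fun f hf => hf.2⟩
      have hI' : homogeneousIdeal (W : Set (PSpace K n)) = Q := hI
      have hWZ : W < Z := by
        refine lt_of_le_not_ge (subset_of_homogeneousIdeal_le Z.isClosed ?_) fun h => ?_
        · rw [hI']
          exact hIQ.le
        · have h1 : homogeneousIdeal (W : Set (PSpace K n)) ≤ homogeneousIdeal (Z : Set (PSpace K n)) :=
            homogeneousIdeal_anti h
          rw [hI'] at h1
          exact hIQ.not_ge h1
      have hW : hilbertPolynomial (W : Set (PSpace K n)) = R := by
        refine (isHilbertPoly_hilbertPolynomial _).unique ?_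
        rwa [hI']
      calc ((d + 1 : ℕ) : ℕ∞) = d + 1 := by push_cast; rfl
        _ ≤ Order.height W + 1 := by
          gcongr
          exact ih W (by rw [hW, hRd])
        _ ≤ Order.height Z := Order.height_add_one_le hWZ

theorem isIrreducible_of_isInducing_of_image {S T : Type*} [TopologicalSpace S]
    [TopologicalSpace T] {f : S → T} (hf : Topology.IsInducing f) {s : Set S}
    (hs : IsIrreducible (f '' s)) : IsIrreducible s := by
  refine ⟨Set.image_nonempty.1 hs.1, ?_⟩
  intro u' v' hu' hv' hsu hsv
  obtain ⟨u, hu, rfl⟩ := hf.isOpen_iff.1 hu'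
  obtain ⟨v, hv, rfl⟩ := hf.isOpen_iff.1 hv'
  obtain ⟨a, ha, hau⟩ := hsu
  obtain ⟨b, hb, hbv⟩ := hsv
  obtain ⟨_, ⟨x, hx, rfl⟩, hxu, hxv⟩ := hs.2 u v hu hv ⟨f a, ⟨a, ha, rfl⟩, hau⟩
    ⟨f b, ⟨b, hb, rfl⟩, hbv⟩
  exact ⟨x, hx, hxu, hxv⟩

open TopologicalSpace in
/-- The dimension of an irreducible closed subspace is its height among all such. -/
theorem topologicalKrullDim_coe_eq_height {T : Type*} [TopologicalSpace T]
    (Z : IrreducibleCloseds T) : topologicalKrullDim (Z : Set T) = Order.height Z := by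
  rw [Order.height_eq_krullDim_Iic, topologicalKrullDim]
  apply le_antisymm
  · have hmono := IrreducibleCloseds.map_strictMono_of_isInducing
      (Topology.IsInducing.subtypeVal (t := (Z : Set T)))
    refine Order.krullDim_le_of_strictMono (fun W => ⟨IrreducibleCloseds.map Subtype.val
      continuous_subtype_val W, ?_⟩) fun A B h => hmono h
    refine closure_minimal ?_ Z.isClosed
    rintro _ ⟨x, -, rfl⟩
    exact x.2
  · let v : ↥(Z : Set T) → T := Subtype.val
    have himg : ∀ W : Set.Iic Z, v '' (v ⁻¹' (W.1 : Set T)) = (W.1 : Set T) := fun W =>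
      (Subtype.image_preimage_coe _ _).trans (Set.inter_eq_right.2 W.2)
    refine Order.krullDim_le_of_strictMono (fun W => ⟨v ⁻¹' (W.1 : Set T),
      ?_, W.1.isClosed.preimage continuous_subtype_val⟩) fun A B h => ?_
    · refine isIrreducible_of_isInducing_of_image Topology.IsInducing.subtypeVal ?_
      change IsIrreducible (v '' (v ⁻¹' (W.1 : Set T)))
      rw [himg]
      exact W.1.isIrreducible
    · refine lt_of_le_not_ge (fun x hx => h.le hx) fun hBA => h.not_ge ?_
      have : v '' (v ⁻¹' (B.1 : Set T)) ⊆ v '' (v ⁻¹' (A.1 : Set T)) := Set.image_mono hBA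
      rwa [himg, himg] at this

theorem dim_eq_natDegree [IsAlgClosed K] {X : Set (PSpace K n)} (hX : IsVariety X) :
    dim X = ((hilbertPolynomial X).natDegree : ℕ) := by
  have h1 := topologicalKrullDim_coe_eq_height
    (⟨X, hX.2, hX.1⟩ : TopologicalSpace.IrreducibleCloseds (PSpace K n))
  rw [height_eq_natDegree] at h1
  exact h1

theorem degree_eq [IsAlgClosed K] {X : Set (PSpace K n)} (hX : IsVariety X) :
    degree X = ((hilbertPolynomial X).natDegree.factorial : ℚ) *
      (hilbertPolynomial X).leadingCoeff := by
  rw [degree, dim_eq_natDegree hX]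
  rfl

end Projective

/-! ### Tensor products of function spaces -/

section FunctionTensor

variable (K : Type*) [Field K] (α β : Type*)

/-- The bilinear map taking two functions to the function `(a, b) ↦ u a * v b`. -/
def funMul : (α → K) →ₗ[K] (β → K) →ₗ[K] (α × β → K) :=
  LinearMap.mk₂ K (fun u v x => u x.1 * v x.2)
    (fun _ _ _ => funext fun _ => add_mul _ _ _)
    (fun _ _ _ => funext fun _ => mul_assoc _ _ _)
    (fun _ _ _ => funext fun _ => mul_add _ _ _)
    (fun _ _ _ => funext fun _ => mul_left_comm _ _ _)

variable {K α β}

@[simp]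
theorem funMul_apply (u : α → K) (v : β → K) (x : α × β) : funMul K α β u v x = u x.1 * v x.2 := rfl

/-- With `b` fixed, independence of `u` kills each `∑ j, c (i, j) * v j b`; letting `b` vary,
independence of `v` kills the `c (i, j)`. -/
theorem linearIndependent_funMul {ι κ : Type*} [Finite ι] [Finite κ] {u : ι → α → K}
    {v : κ → β → K} (hu : LinearIndependent K u) (hv : LinearIndependent K v) :
    LinearIndependent K fun x : ι × κ => funMul K α β (u x.1) (v x.2) := by
  have := Fintype.ofFinite ι
  have := Fintype.ofFinite κ
  rw [Fintype.linearIndependent_iff] at hu hv ⊢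
  intro c hc x
  refine hv (fun j => c (x.1, j)) (funext fun b => ?_) x.2
  have := hu (fun i => ∑ j, c (i, j) * v j b) (funext fun a => ?_) x.1
  · simpa using this
  · have h := congrFun hc (a, b)
    simp only [Finset.sum_apply, Pi.smul_apply, smul_eq_mul, funMul_apply, Pi.zero_apply,
      Fintype.sum_prod_type] at h ⊢
    rw [← h]
    refine Finset.sum_congr rfl fun i _ => ?_
    rw [Finset.sum_mul]
    exact Finset.sum_congr rfl fun j _ => by ring

theorem span_range_finBasis {M : Type*} [AddCommGroup M] [Module K M] (U : Submodule K M)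
    [Module.Finite K U] : Submodule.span K (Set.range fun i => (Module.finBasis K U i : M)) = U := by
  have := congrArg (Submodule.map U.subtype) (Module.finBasis K U).span_eq
  rwa [Submodule.map_span, Submodule.map_subtype_top, ← Set.range_comp] at this

theorem finrank_map₂_funMul (V : Submodule K (α → K)) (W : Submodule K (β → K))
    [Module.Finite K V] [Module.Finite K W] :
    Module.finrank K (Submodule.map₂ (funMul K α β) V W) =
      Module.finrank K V * Module.finrank K W := by
  have hli := linearIndependent_funMul
    ((Module.finBasis K V).linearIndependent.map' V.subtype (Submodule.ker_subtype V))
    ((Module.finBasis K W).linearIndependent.map' W.subtype (Submodule.ker_subtype W))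
  have heq : Submodule.map₂ (funMul K α β) V W = Submodule.span K (Set.range
      fun x : Fin (Module.finrank K V) × Fin (Module.finrank K W) => funMul K α β
        ((V.subtype ∘ Module.finBasis K V) x.1) ((W.subtype ∘ Module.finBasis K W) x.2)) := by
    conv_lhs => rw [← span_range_finBasis V, ← span_range_finBasis W, Submodule.map₂_span_span, Set.image2_range]
    rfl
  rw [heq, finrank_span_eq_card hli]
  simp

end FunctionTensor

/-! ### Pairs of linear spaces in general position for the Hadamard product -/

section Hadamard

variable {K : Type*} [Field K] {n : ℕ}

/-- Every product of a coordinate on `L` and a coordinate on `L'` is a linear form in the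
coordinatewise product. -/
def IsHadamardGeneric (L L' : Submodule K (Fin (n + 1) → K)) : Prop :=
  ∀ i j, ∃ φ : (Fin (n + 1) → K) →ₗ[K] K, ∀ p ∈ L, ∀ q ∈ L', p i * q j = φ (p * q)

theorem exists_isHomogeneous_one_eval_eq {σ : Type*} [Finite σ] (φ : (σ → K) →ₗ[K] K) :
    ∃ F : MvPolynomial σ K, F.IsHomogeneous 1 ∧ ∀ v, eval v F = φ v := by
  classical
  have := Fintype.ofFinite σ
  refine ⟨∑ i, C (φ (Pi.single i 1)) * X i,
    IsHomogeneous.sum _ _ _ fun i _ => isHomogeneous_C_mul_X _ i, fun v => ?_⟩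
  conv_rhs => rw [pi_eq_sum_univ' v, map_sum]
  rw [map_sum]
  refine Finset.sum_congr rfl fun i _ => ?_
  rw [map_smul, map_mul, eval_C, eval_X, smul_eq_mul, mul_comm]

theorem IsHadamardGeneric.mul_ne_zero {L L' : Submodule K (Fin (n + 1) → K)}
    (h : IsHadamardGeneric L L') {p q : Fin (n + 1) → K} (hp : p ∈ L) (hq : q ∈ L')
    (hp0 : p ≠ 0) (hq0 : q ≠ 0) : p * q ≠ 0 := by
  intro hpq
  obtain ⟨i, hi⟩ := Function.ne_iff.1 hp0
  obtain ⟨j, hj⟩ := Function.ne_iff.1 hq0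
  obtain ⟨φ, hφ⟩ := h i j
  have := hφ p hp q hq
  rw [hpq, map_zero] at this
  exact _root_.mul_ne_zero hi hj this

/-- Both monomials have `t` factors, so these can be paired off into `t` products `p_i q_j`, each
linear in `p * q`. -/
theorem IsHadamardGeneric.exists_monomial {L L' : Submodule K (Fin (n + 1) → K)}
    (h : IsHadamardGeneric L L') (t : ℕ) (a b : Fin (n + 1) →₀ ℕ) (ha : a.degree = t)
    (hb : b.degree = t) : ∃ F : MvPolynomial (Fin (n + 1)) K, F.IsHomogeneous t ∧
      ∀ p ∈ L, ∀ q ∈ L', eval p (monomial a 1) * eval q (monomial b 1) = eval (p * q) F := by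
  have hsplit : ∀ (t : ℕ) (a : Fin (n + 1) →₀ ℕ), a.degree = t + 1 →
      ∃ i a', a = Finsupp.single i 1 + a' ∧ a'.degree = t := by
    intro t a ha
    obtain ⟨i, hi⟩ : ∃ i, a i ≠ 0 := by
      by_contra! hcon
      rw [Finsupp.ext hcon (g := 0), map_zero] at ha
      omega
    have hle : Finsupp.single i 1 ≤ a := Finsupp.single_le_iff.2 (Nat.one_le_iff_ne_zero.2 hi)
    refine ⟨i, a - Finsupp.single i 1, (add_tsub_cancel_of_le hle).symm, ?_⟩
    have := congrArg Finsupp.degree (add_tsub_cancel_of_le hle)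
    rw [map_add, Finsupp.degree_single, ha] at this
    omega
  induction t generalizing a b with
  | zero =>
    rw [Finsupp.degree_eq_zero_iff] at ha hb
    subst ha hb
    exact ⟨1, isHomogeneous_one _ _, by simp⟩
  | succ t ih =>
    obtain ⟨i, a, rfl, ha'⟩ := hsplit t a ha
    obtain ⟨j, b, rfl, hb'⟩ := hsplit t b hb
    obtain ⟨F, hF, hFe⟩ := ih a b ha' hb'
    obtain ⟨φ, hφ⟩ := h i j
    obtain ⟨G, hG, hGe⟩ := exists_isHomogeneous_one_eval_eq φ
    refine ⟨F * G, hF.mul hG, fun p hp q hq => ?_⟩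
    rw [map_mul, ← hFe p hp q hq, hGe, ← hφ p hp q hq, ← one_mul (1 : K), ← monomial_mul,
      ← monomial_mul]
    simp only [map_mul, one_mul, eval_monomial, Finsupp.prod_single_index, pow_zero, pow_one]
    ring

theorem IsHadamardGeneric.exists_eval_mul_eval_eq {L L' : Submodule K (Fin (n + 1) → K)}
    (h : IsHadamardGeneric L L') {t : ℕ} {a b : MvPolynomial (Fin (n + 1)) K}
    (ha : a.IsHomogeneous t) (hb : b.IsHomogeneous t) :
    ∃ F : MvPolynomial (Fin (n + 1)) K, F.IsHomogeneous t ∧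
      ∀ p ∈ L, ∀ q ∈ L', eval p a * eval q b = eval (p * q) F := by
  have hdeg : ∀ {a : MvPolynomial (Fin (n + 1)) K}, a.IsHomogeneous t →
      ∀ m ∈ a.support, m.degree = t := fun {a} ha m hm => by
    by_contra hne
    exact (mem_support_iff.1 hm) (ha.coeff_eq_zero hne)
  choose! F hF hFe using h.exists_monomial t
  refine ⟨∑ m ∈ a.support, ∑ m' ∈ b.support, C (coeff m a * coeff m' b) * F m m', ?_, ?_⟩
  · exact IsHomogeneous.sum _ _ _ fun m hm => IsHomogeneous.sum _ _ _ fun m' hm' =>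
      (hF m m' (hdeg ha m hm) (hdeg hb m' hm')).C_mul _
  · intro p hp q hq
    conv_lhs => rw [a.as_sum, b.as_sum]
    simp only [map_sum, map_mul, eval_C, Finset.sum_mul_sum]
    refine Finset.sum_congr rfl fun m hm => Finset.sum_congr rfl fun m' hm' => ?_
    rw [← hFe m m' (hdeg ha m hm) (hdeg hb m' hm') p hp q hq]
    simp only [eval_monomial]
    ring

/-- The set of coordinatewise products of points of `X` and `Y`. -/
def hadamardSet (X Y : Set (PSpace K n)) : Set (PSpace K n) :=
  {z | ∃ p ∈ X, ∃ q ∈ Y, ∃ h : p.rep * q.rep ≠ 0, z = Projectivization.mk K (p.rep * q.rep) h}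

theorem rep_mem_of_subset {X : Set (PSpace K n)} {L : Submodule K (Fin (n + 1) → K)}
    (hX : X ⊆ linearSubspace L) {p : PSpace K n} (hp : p ∈ X) : p.rep ∈ L := by
  have h : p.submodule ≤ L := hX hp
  rw [Projectivization.submodule_eq] at h
  exact h (Submodule.mem_span_singleton_self _)

variable {L L' : Submodule K (Fin (n + 1) → K)} {X Y : Set (PSpace K n)}

theorem forall_hadamardSet_iff (h : IsHadamardGeneric L L') (hX : X ⊆ linearSubspace L)
    (hY : Y ⊆ linearSubspace L') {f : MvPolynomial (Fin (n + 1)) K} (hf : IsForm f) :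
    (∀ z ∈ hadamardSet X Y, eval z.rep f = 0) ↔
      ∀ p ∈ X, ∀ q ∈ Y, eval (p.rep * q.rep) f = 0 := by
  constructor
  · intro H p hp q hq
    have hne := h.mul_ne_zero (rep_mem_of_subset hX hp) (rep_mem_of_subset hY hq) p.rep_nonzero
      q.rep_nonzero
    exact (eval_mk_rep_eq_zero_iff hf hne).1 (H _ ⟨p, hp, q, hq, hne, rfl⟩)
  · rintro H _ ⟨p, hp, q, hq, hne, rfl⟩
    exact (eval_mk_rep_eq_zero_iff hf hne).2 (H p hp q hq)

/-- Substituting `v i * x i` for `x i`. -/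
def scaleVars (v : Fin (n + 1) → K) (f : MvPolynomial (Fin (n + 1)) K) :
    MvPolynomial (Fin (n + 1)) K :=
  bind₁ (fun i => C (v i) * MvPolynomial.X i) f

theorem eval_scaleVars (v x : Fin (n + 1) → K) (f : MvPolynomial (Fin (n + 1)) K) :
    eval x (scaleVars v f) = eval (v * x) f := by
  rw [scaleVars, ← aeval_eq_eval, ← aeval_eq_eval, aeval_bind₁]
  simp
  rfl

theorem isForm_scaleVars (v : Fin (n + 1) → K) {f : MvPolynomial (Fin (n + 1)) K}
    (hf : IsForm f) : IsForm (scaleVars v f) := by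
  obtain ⟨d, hd⟩ := hf
  have := hd.aeval (fun i => C (v i) * MvPolynomial.X i) (n := 1) fun i => isHomogeneous_C_mul_X _ i
  exact ⟨_, this⟩

/-- As for a product of irreducible spaces: irreducibility of `X` decides for each `q` which of `f`,
`g` vanishes on all products with `q`. The two resulting conditions on `q` are closed and cover `Y`,
so one of them holds throughout `Y`. -/
theorem isVariety_hadamard (h : IsHadamardGeneric L L') (hX : X ⊆ linearSubspace L)
    (hY : Y ⊆ linearSubspace L') (hXi : IsIrreducible X) (hYi : IsIrreducible Y) :
    IsVariety (hadamard X Y) := by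
  refine ⟨isClosed_closure, IsIrreducible.closure (s := hadamardSet X Y) ?_⟩
  refine isIrreducible_of_forall_isForm ?_ fun f g hf hg hfg => ?_
  · obtain ⟨p, hp⟩ := hXi.1
    obtain ⟨q, hq⟩ := hYi.1
    exact ⟨_, p, hp, q, hq, h.mul_ne_zero (rep_mem_of_subset hX hp) (rep_mem_of_subset hY hq)
      p.rep_nonzero q.rep_nonzero, rfl⟩
  have hfg' : ∀ p ∈ X, ∀ q ∈ Y, eval (p.rep * q.rep) f = 0 ∨ eval (p.rep * q.rep) g = 0 := by
    intro p hp q hq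
    have hne := h.mul_ne_zero (rep_mem_of_subset hX hp) (rep_mem_of_subset hY hq) p.rep_nonzero
      q.rep_nonzero
    exact (hfg _ ⟨p, hp, q, hq, hne, rfl⟩).imp (eval_mk_rep_eq_zero_iff hf hne).1
      (eval_mk_rep_eq_zero_iff hg hne).1
  rw [forall_hadamardSet_iff h hX hY hf, forall_hadamardSet_iff h hX hY hg]
  have hq : ∀ q ∈ Y, (∀ p ∈ X, eval (p.rep * q.rep) f = 0) ∨
      ∀ p ∈ X, eval (p.rep * q.rep) g = 0 := by
    intro q hq
    have := forall_eval_eq_zero_or_of_isIrreducible hXi (T₁ := {scaleVars q.rep f})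
      (T₂ := {scaleVars q.rep g}) (by rintro _ rfl; exact isForm_scaleVars _ hf)
      (by rintro _ rfl; exact isForm_scaleVars _ hg) fun p hp => by
        simpa [eval_scaleVars, mul_comm] using hfg' p hp q hq
    simpa [eval_scaleVars, mul_comm] using this
  have := forall_eval_eq_zero_or_of_isIrreducible hYi
    (T₁ := (fun p : PSpace K n => scaleVars p.rep f) '' X)
    (T₂ := (fun p : PSpace K n => scaleVars p.rep g) '' X)
    (by rintro _ ⟨p, -, rfl⟩; exact isForm_scaleVars _ hf)
    (by rintro _ ⟨p, -, rfl⟩; exact isForm_scaleVars _ hg) fun q hqY => by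
      simpa [eval_scaleVars] using hq q hqY
  simp only [Set.forall_mem_image, eval_scaleVars] at this
  exact this.imp (fun H p hp q hq => H q hq hp) fun H p hp q hq => H q hq hp

/-! ### The Hilbert function of a Hadamard product -/

theorem HF_eq_finrank_range {M : Type*} [AddCommGroup M] [Module K M] {t : ℕ}
    (φ : homogeneousSubmodule (Fin (n + 1)) K t →ₗ[K] M)
    (hφ : ∀ f, φ f = 0 ↔ (f : MvPolynomial (Fin (n + 1)) K) ∈ homogeneousIdeal X) :
    HF X t = Module.finrank K (LinearMap.range φ) := by
  have := (HF_eq_idealHF X t).trans (finrank_range_eq_idealHF φ hφ).symm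
  exact_mod_cast this

/-- Evaluation of forms of degree `t` at a family of vectors. -/
def evalForms {ι : Type*} (v : ι → Fin (n + 1) → K) (t : ℕ) :
    homogeneousSubmodule (Fin (n + 1)) K t →ₗ[K] (ι → K) :=
  LinearMap.pi fun x => (aeval (v x)).toLinearMap ∘ₗ (homogeneousSubmodule (Fin (n + 1)) K t).subtype

@[simp]
theorem evalForms_apply {ι : Type*} (v : ι → Fin (n + 1) → K) (t : ℕ)
    (f : homogeneousSubmodule (Fin (n + 1)) K t) (x : ι) :
    evalForms v t f x = eval (v x) (f : MvPolynomial (Fin (n + 1)) K) := by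
  simp [evalForms, aeval_eq_eval]

theorem HF_eq_finrank_range_evalForms (X : Set (PSpace K n)) (t : ℕ) :
    HF X t = Module.finrank K (LinearMap.range (evalForms (fun p : X => p.1.rep) t)) := by
  refine HF_eq_finrank_range _ fun f => ?_
  rw [mem_homogeneousIdeal_iff ⟨t, f.2⟩, funext_iff]
  simp

theorem HF_hadamard (h : IsHadamardGeneric L L') (hX : X ⊆ linearSubspace L)
    (hY : Y ⊆ linearSubspace L') (t : ℕ) : HF (hadamard X Y) t = HF X t * HF Y t := by
  have h1 : HF (hadamard X Y) t = Module.finrank K (LinearMap.range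
      (evalForms (fun x : X × Y => x.1.1.rep * x.2.1.rep) t)) := by
    refine HF_eq_finrank_range _ fun f => ?_
    have hI : homogeneousIdeal (hadamard X Y) = homogeneousIdeal (hadamardSet X Y) :=
      homogeneousIdeal_closure _
    rw [hI, mem_homogeneousIdeal_iff ⟨t, f.2⟩, forall_hadamardSet_iff h hX hY ⟨t, f.2⟩, funext_iff]
    simp only [evalForms_apply, Prod.forall, Subtype.forall, Pi.zero_apply]
  rw [h1, HF_eq_finrank_range_evalForms X, HF_eq_finrank_range_evalForms Y,
    ← finrank_map₂_funMul]
  suffices hr : LinearMap.range (evalForms (fun x : X × Y => x.1.1.rep * x.2.1.rep) t) =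
      Submodule.map₂ (funMul K X Y) (LinearMap.range (evalForms (fun p : X => p.1.rep) t))
        (LinearMap.range (evalForms (fun q : Y => q.1.rep) t)) by rw [hr]
  apply le_antisymm
  -- A monomial is multiplicative in `p * q`; this inclusion does not depend on genericity.
  · rintro _ ⟨⟨f, hf⟩, rfl⟩
    have hsum : evalForms (fun x : X × Y => x.1.1.rep * x.2.1.rep) t ⟨f, hf⟩ =
        ∑ m ∈ f.support.attach, coeff m.1 f • funMul K X Y
          (evalForms (fun p : X => p.1.rep) t ⟨monomial m.1 1, isHomogeneous_monomial _ (by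
            by_contra hne
            exact (mem_support_iff.1 m.2) (IsHomogeneous.coeff_eq_zero hf hne))⟩)
          (evalForms (fun q : Y => q.1.rep) t ⟨monomial m.1 1, isHomogeneous_monomial _ (by
            by_contra hne
            exact (mem_support_iff.1 m.2) (IsHomogeneous.coeff_eq_zero hf hne))⟩) := by
      funext x
      simp only [evalForms_apply, Finset.sum_apply, Pi.smul_apply, funMul_apply, smul_eq_mul,
        eval_monomial, one_mul]
      rw [eval_eq', ← Finset.sum_attach]
      refine Finset.sum_congr rfl fun m _ => ?_
      simp [Finsupp.prod_fintype, mul_pow, Finset.prod_mul_distrib]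
    rw [hsum]
    exact sum_mem fun m _ => Submodule.smul_mem _ _
      (Submodule.apply_mem_map₂ _ (LinearMap.mem_range_self _ _) (LinearMap.mem_range_self _ _))
  -- Genericity enters here: `a(p) b(q)` is a form of degree `t` in `p * q`.
  · refine Submodule.map₂_le.2 ?_
    rintro _ ⟨⟨a, ha⟩, rfl⟩ _ ⟨⟨b, hb⟩, rfl⟩
    obtain ⟨F, hF, hFe⟩ := h.exists_eval_mul_eval_eq ha hb
    refine ⟨⟨F, hF⟩, funext fun x => ?_⟩
    simp only [evalForms_apply, funMul_apply]
    exact (hFe _ (rep_mem_of_subset hX x.1.2) _ (rep_mem_of_subset hY x.2.2)).symm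

theorem hilbertPolynomial_hadamard (h : IsHadamardGeneric L L') (hX : X ⊆ linearSubspace L)
    (hY : Y ⊆ linearSubspace L') :
    hilbertPolynomial (hadamard X Y) = hilbertPolynomial X * hilbertPolynomial Y := by
  refine (isHilbertPoly_hilbertPolynomial _).unique (isHilbertPoly_homogeneousIdeal_iff.2 ?_)
  filter_upwards [isHilbertPoly_homogeneousIdeal_iff.1 (isHilbertPoly_hilbertPolynomial X),
    isHilbertPoly_homogeneousIdeal_iff.1 (isHilbertPoly_hilbertPolynomial Y)] with t h1 h2
  rw [HF_hadamard h hX hY, Polynomial.eval_mul, ← h1, ← h2]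
  push_cast
  rfl

/-! ### Genericity -/

/-- For `p = A u`, `q = B v`, the coordinates of `p * q` selected by `e` form the vector `M (u ⊗
v)`. Applying `M⁻¹` recovers every `u_a v_b`, and `p_i q_j` is a combination of these. -/
theorem isHadamardGeneric_colSpace {h k : ℕ} (e : Fin (h + 1) × Fin (k + 1) → Fin (n + 1))
    {A : Matrix (Fin (n + 1)) (Fin (h + 1)) K} {B : Matrix (Fin (n + 1)) (Fin (k + 1)) K}
    (hdet : (Matrix.of fun x y : Fin (h + 1) × Fin (k + 1) =>
      A (e x) y.1 * B (e x) y.2).det ≠ 0) :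
    IsHadamardGeneric (colSpace A) (colSpace B) := by
  set M := Matrix.of fun x y : Fin (h + 1) × Fin (k + 1) => A (e x) y.1 * B (e x) y.2 with hM
  intro i j
  refine ⟨∑ x, (A i x.1 * B j x.2) •
    (LinearMap.proj x ∘ₗ M⁻¹.mulVecLin ∘ₗ LinearMap.funLeft K K e), ?_⟩
  intro p hp q hq
  rw [colSpace, ← Matrix.range_mulVecLin] at hp hq
  obtain ⟨u, rfl⟩ := hp
  obtain ⟨v, rfl⟩ := hq
  simp only [Matrix.mulVecLin_apply]
  have h1 : LinearMap.funLeft K K e (A.mulVec u * B.mulVec v) = M.mulVec fun x => u x.1 * v x.2 := by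
    funext x
    simp only [LinearMap.funLeft_apply, Pi.mul_apply, Matrix.mulVec, dotProduct, hM, Matrix.of_apply,
      Finset.sum_mul_sum, Fintype.sum_prod_type]
    exact Finset.sum_congr rfl fun a _ => Finset.sum_congr rfl fun b _ => by ring
  simp only [LinearMap.sum_apply, LinearMap.smul_apply, LinearMap.comp_apply, h1,
    Matrix.mulVecLin_apply, Matrix.mulVec_mulVec,
    Matrix.nonsing_inv_mul M (isUnit_iff_ne_zero.2 hdet), Matrix.one_mulVec, LinearMap.proj_apply,
    smul_eq_mul]
  simp only [Matrix.mulVec, dotProduct, Finset.sum_mul_sum, Fintype.sum_prod_type]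
  exact Finset.sum_congr rfl fun a _ => Finset.sum_congr rfl fun b _ => by ring

/-- Generic pairs of linear spaces are in general position for the Hadamard product. -/
theorem exists_polynomial_isHadamardGeneric (K : Type*) [Field K] (n h k : ℕ)
    (hn : (h + 1) * (k + 1) - 1 ≤ n) :
    ∃ F : MvPolynomial ((Fin (n + 1) × Fin (h + 1)) ⊕ (Fin (n + 1) × Fin (k + 1))) K, F ≠ 0 ∧
      ∀ (A : Matrix (Fin (n + 1)) (Fin (h + 1)) K) (B : Matrix (Fin (n + 1)) (Fin (k + 1)) K),
        eval (Sum.elim (fun ij => A ij.1 ij.2) (fun ij => B ij.1 ij.2)) F ≠ 0 →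
        IsHadamardGeneric (colSpace A) (colSpace B) := by
  obtain ⟨e⟩ : Nonempty (Fin (h + 1) × Fin (k + 1) ↪ Fin (n + 1)) := by
    refine Function.Embedding.nonempty_of_card_le ?_
    simp only [Fintype.card_prod, Fintype.card_fin]
    omega
  set M : Matrix (Fin (h + 1) × Fin (k + 1)) (Fin (h + 1) × Fin (k + 1))
      (MvPolynomial ((Fin (n + 1) × Fin (h + 1)) ⊕ (Fin (n + 1) × Fin (k + 1))) K) :=
    Matrix.of fun x y => MvPolynomial.X (Sum.inl (e x, y.1)) * MvPolynomial.X (Sum.inr (e x, y.2))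
    with hM
  have heval : ∀ (A : Matrix (Fin (n + 1)) (Fin (h + 1)) K)
      (B : Matrix (Fin (n + 1)) (Fin (k + 1)) K),
      eval (Sum.elim (fun ij => A ij.1 ij.2) (fun ij => B ij.1 ij.2)) M.det =
        (Matrix.of fun x y : Fin (h + 1) × Fin (k + 1) => A (e x) y.1 * B (e x) y.2).det := by
    intro A B
    rw [RingHom.map_det]
    congr 1
    ext x y
    simp [hM]
  refine ⟨M.det, fun h0 => ?_, fun A B hAB => isHadamardGeneric_colSpace e (heval A B ▸ hAB)⟩
  -- Specialise row `e (a, b)` of `A` to the `a`-th unit vector and that of `B` to the `b`-th; the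
  -- matrix becomes the identity. Rows outside the range of `e` play no role.
  have := heval (fun l a => if (Function.invFun e l).1 = a then 1 else 0)
    (fun l b => if (Function.invFun e l).2 = b then 1 else 0)
  have hone : (Matrix.of fun x y : Fin (h + 1) × Fin (k + 1) =>
      (if (Function.invFun e (e x)).1 = y.1 then (1 : K) else 0) *
        if (Function.invFun e (e x)).2 = y.2 then 1 else 0) = 1 := by
    ext x y
    rw [Matrix.of_apply, Function.leftInverse_invFun e.injective x, Matrix.one_apply]
    rcases x with ⟨a, b⟩
    rcases y with ⟨c, d⟩
    by_cases h1 : a = c <;> by_cases h2 : b = d <;> simp [h1, h2]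
  rw [h0, map_zero, hone, Matrix.det_one] at this
  exact zero_ne_one this

end Hadamard

end HadamardProj

end

theorem mainTheorem2 (K : Type*) [Field K] [IsAlgClosed K] [CharZero K]
    (n h k : ℕ) (hn : (h + 1) * (k + 1) - 1 ≤ n) :
    HadamardProj.ForGenericPair K n h k fun L L' =>
      ∀ X Y : Set (HadamardProj.PSpace K n),
        HadamardProj.IsVariety X → HadamardProj.IsVariety Y → X ⊆ L → Y ⊆ L' →
        ∀ r s : ℕ, HadamardProj.dim X = r → HadamardProj.dim Y = s →
          HadamardProj.dim (HadamardProj.hadamard X Y) = ((r + s : ℕ) : WithBot ℕ∞) ∧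
          HadamardProj.degree (HadamardProj.hadamard X Y) =
            ((r + s).choose s : ℚ) * HadamardProj.degree X * HadamardProj.degree Y ∧
          ∀ t : ℕ, HadamardProj.HF (HadamardProj.hadamard X Y) t =
            HadamardProj.HF X t * HadamardProj.HF Y t := by
  obtain ⟨F, hF, hgen⟩ := HadamardProj.exists_polynomial_isHadamardGeneric K n h k hn
  refine ⟨F, hF, fun A B _ _ hAB X Y hX hY hXL hYL r s hr hs => ?_⟩
  have hg := hgen A B hAB
  have hXY := HadamardProj.isVariety_hadamard hg hXL hYL hX.2 hY.2
  have hP := HadamardProj.hilbertPolynomial_hadamard hg hXL hYL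
  rw [HadamardProj.dim_eq_natDegree hX] at hr
  rw [HadamardProj.dim_eq_natDegree hY] at hs
  obtain rfl : _ = r := by exact_mod_cast hr
  obtain rfl : _ = s := by exact_mod_cast hs
  have hdeg : (HadamardProj.hilbertPolynomial (HadamardProj.hadamard X Y)).natDegree =
      (HadamardProj.hilbertPolynomial X).natDegree +
        (HadamardProj.hilbertPolynomial Y).natDegree := by
    rw [hP, Polynomial.natDegree_mul (HadamardProj.hilbertPolynomial_ne_zero hX.2)
      (HadamardProj.hilbertPolynomial_ne_zero hY.2)]
  refine ⟨?_, ?_, HadamardProj.HF_hadamard hg hXL hYL⟩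
  · rw [HadamardProj.dim_eq_natDegree hXY, hdeg]
  -- The binomial coefficient arises from `(r + s)! = (r + s).choose s * r! * s!`.
  · rw [HadamardProj.degree_eq hXY, HadamardProj.degree_eq hX, HadamardProj.degree_eq hY, hdeg, hP,
      Polynomial.leadingCoeff_mul, ← Nat.add_choose_mul_factorial_mul_factorial]
    push_cast
    ring
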